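/- Let $G$ be a finitely generated (discrete) group and let $\pi$ be a unitary representation of $G$ on a (real or complex) Hilbert space $\mathcal H$. A set $L\subset G$ is called syndetic if $FL=G$ for some finite $F\subset G$, and thickly syndetic if $\bigcap_{g\in F} gL$ is syndetic for every finite $F\subset G$. Assume that $\pi$ is weakly mixing, i.e. for all $\eta,\xi\in\mathcal H$ and all $\varepsilon>0$ the set $\{x\in G : |\langle \eta,\pi(x)\xi\rangle|\le\varepsilon\}$ is thickly syndetic. A cocycle is a map $b:G\to\mathcal H$ with $b(gh)=b(g)+\pi(g)b(h)$ for all $g,h\in G$; let $Z^1(G,\pi)$ be the space of cocycles with the topology of pointwise convergence, $B^1(G,\pi)$ the subspace of coboundaries $g\mapsto\pi(g)\xi-\xi$ ($\xi\in\mathcal H$), and $\overline{H}^1(G,\pi)=Z^1(G,\pi)/\overline{B^1(G,\pi)}$. Assume that $\overline{H}^1(G,\pi)\neq 0$. Let $\mu$ be a symmetric probability measure on $G$ (i.e. $\mu(s^{-1})=\mu(s)$) whose support is a finite generating set $S$ of $G$, and let $b$ be a non-zero $\mu$-harmonic cocycle, i.e. $b\in Z^1(G,\pi)$, $b\ne 0$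 and $\sum_{s\in S}\mu(s)b(s)=0$. Then $$Z^{FC}(G)\subset \ker b\,\cap\,\ker \pi_{|\operatorname{im} b},$$ where $Z^{FC}(G)$ is the set of elements of $G$ with finite conjugacy class, $\ker b=b^{-1}(0)$, and $\ker\pi_{|\operatorname{im} b}$ is the set of $g\in G$ such that $\pi(g)$ is the identity on $\operatorname{im} b$ (equivalently, on the closed linear span of $b(G)$). That is, every $z\in G$ with finite conjugacy class satisfies $b(z)=0$ and $\pi(z)\xi=\xi$ for every $\xi$ in the closed linear span of $b(G)$. -/

import Mathlib

open scoped Pointwise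

noncomputable section

namespace FCCocycle

/-! ### FC-centre -/

/-- The FC-centraliser of `S` in `G`: elements `g` such that `{h⁻¹ g h | h ∈ S}` is finite. -/
def fcCentralizer {G : Type*} [Group G] (S : Set G) : Set G :=
  {g | ((fun h : G => h⁻¹ * g * h) '' S).Finite}

/-- The FC-centre of `G`: the elements with a finite conjugacy class. -/
def fcCenter (G : Type*) [Group G] : Set G :=
  fcCentralizer (Set.univ : Set G)

/-! ### Thickly syndetic sets, flight functions, weak mixing -/

/-- `L` is syndetic if `S L = G` for some finite `S`. -/
def IsSyndetic {G : Type*} [Group G] (L : Set G) : Prop :=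
  ∃ S : Set G, S.Finite ∧ S * L = Set.univ

/-- `L` is thickly syndetic if every finite intersection of left translates of `L` is syndetic. -/
def IsThicklySyndetic {G : Type*} [Group G] (L : Set G) : Prop :=
  ∀ F : Set G, F.Finite → IsSyndetic (⋂ g ∈ F, g • L)

/-- A flight function: for every `ε > 0` the set `{x | |f x| ≤ ε}` is thickly syndetic. -/
def IsFlight {G : Type*} [Group G] {𝕜 : Type*} [RCLike 𝕜] (f : G → 𝕜) : Prop :=
  ∀ ε : ℝ, 0 < ε → IsThicklySyndetic {x : G | ‖f x‖ ≤ ε}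

section Rep

variable {𝕜 : Type*} [RCLike 𝕜] {G : Type*} [Group G]
  {H : Type*} [NormedAddCommGroup H] [InnerProductSpace 𝕜 H]

/-- The coefficient `x ↦ ⟨η, π(x) ξ⟩` of a unitary representation `π`. -/
def coeff (π : G →* (H ≃ₗᵢ[𝕜] H)) (η ξ : H) : G → 𝕜 :=
  fun x => inner 𝕜 η (π x ξ)

/-- `π` is weakly mixing if all its coefficients are flight functions. -/
def IsWeaklyMixing (π : G →* (H ≃ₗᵢ[𝕜] H)) : Prop :=
  ∀ η ξ : H, IsFlight (coeff π η ξ)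

/-! ### Cocycles and reduced cohomology in degree one -/

/-- The space `Z¹(G, π)` of cocycles. As a subspace of `G → H` it carries the topology of pointwise
convergence, i.e. (as `G` is discrete) of uniform convergence on compact subsets. -/
def Z1 (π : G →* (H ≃ₗᵢ[𝕜] H)) : Submodule 𝕜 (G → H) where
  carrier := {b | ∀ g h : G, b (g * h) = b g + π g (b h)}
  add_mem' := by
    intro a b ha hb g h
    simp only [Pi.add_apply, ha g h, hb g h, map_add]
    abel
  zero_mem' := by
    intro g h
    simp
  smul_mem' := by
    intro c b hb g h
    simp only [Pi.smul_apply, hb g h, map_smul, smul_add]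

/-- The coboundary map `(dξ)(g) = π(g) ξ - ξ`. -/
def cobdry (π : G →* (H ≃ₗᵢ[𝕜] H)) : H →ₗ[𝕜] Z1 π where
  toFun ξ := ⟨fun g => π g ξ - ξ, by
    intro g h
    simp only [map_mul, LinearIsometryEquiv.coe_mul, Function.comp_apply, map_sub]
    abel⟩
  map_add' := by
    intro ξ η
    ext g
    simp only [map_add, Submodule.coe_add, Pi.add_apply]
    abel
  map_smul' := by
    intro c ξ
    ext g
    simp [smul_sub]

/-- The space `B¹(G, π)` of coboundaries. -/
def B1 (π : G →* (H ≃ₗᵢ[𝕜] H)) : Submodule 𝕜 (Z1 π) :=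
  LinearMap.range (cobdry π)

/-- Reduced cohomology in degree one: cocycles modulo the closure of the coboundaries. -/
abbrev ReducedH1 (π : G →* (H ≃ₗᵢ[𝕜] H)) : Type _ :=
  Z1 π ⧸ (B1 π).topologicalClosure

/-- `μ` is a symmetric probability measure whose support is the finite generating set `S`. -/
structure IsSymmGenMeasure (S : Finset G) (μ : G → ℝ) : Prop where
  pos : ∀ s ∈ S, 0 < μ s
  eq_zero : ∀ s, s ∉ S → μ s = 0
  sum_eq_one : ∑ s ∈ S, μ s = 1
  symm : ∀ s, μ s⁻¹ = μ s
  generates : Subgroup.closure (S : Set G) = ⊤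

/-- The cocycle `b` is `μ`-harmonic (for `μ` supported on the finite set `S`):
`∑ s ∈ S, μ(s) b(s) = 0`. -/
def IsHarmonic {π : G →* (H ≃ₗᵢ[𝕜] H)} (S : Finset G) (μ : G → ℝ) (b : Z1 π) : Prop :=
  ∑ s ∈ S, (μ s : 𝕜) • (b : G → H) s = 0

/-- `ker b = b⁻¹(0)`. -/
def cocycleKer {π : G →* (H ≃ₗᵢ[𝕜] H)} (b : Z1 π) : Set G :=
  {g | (b : G → H) g = 0}

/-- The subrepresentation generated by the image of `b`: the closed linear span of `b(G)`. -/
def cocycleIm {π : G →* (H ≃ₗᵢ[𝕜] H)} (b : Z1 π) : Submodule 𝕜 H :=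
  (Submodule.span 𝕜 (Set.range (b : G → H))).topologicalClosure

/-- The kernel of the restriction of `π` to `V`: the elements acting as the identity on `V`. -/
def kerOn (π : G →* (H ≃ₗᵢ[𝕜] H)) (V : Submodule 𝕜 H) : Set G :=
  {g | ∀ ξ ∈ V, π g ξ = ξ}

end Rep

end FCCocycle

end

namespace FCCocycle

section

variable {𝕜 : Type*} [RCLike 𝕜] {G : Type*} [Group G]
  {H : Type*} [NormedAddCommGroup H] [InnerProductSpace 𝕜 H] {π : G →* (H ≃ₗᵢ[𝕜] H)}

/-! Let `C` be the finite conjugacy class of `z`. By `cocycle_conj`, conjugating `c` by `s` changes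
`b c` by `π c (b s) - b s`, up to an isometry. Expand the squared norm and sum over `c ∈ C` and over
`s` with weight `μ s`: conjugation permutes `C`, harmonicity kills the cross terms, so every `π c (b
s) - b s` vanishes. Hence `π z` fixes `b`'s image. Then `b z` is fixed by the centralizer of `z`,
which has finite index, and weak mixing forces `b z = 0`. -/

theorem cocycle_mul (b : Z1 π) (g h : G) :
    (b : G → H) (g * h) = (b : G → H) g + π g ((b : G → H) h) :=
  b.2 g h

theorem cocycle_one (b : Z1 π) : (b : G → H) 1 = 0 := by
  have h := cocycle_mul b 1 1
  simpa using h

theorem cocycle_inv (b : Z1 π) (g : G) :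
    (b : G → H) g⁻¹ = -π g⁻¹ ((b : G → H) g) := by
  have h := cocycle_mul b g⁻¹ g
  rw [inv_mul_cancel, cocycle_one b] at h
  exact eq_neg_of_add_eq_zero_left h.symm

/-- Expand `b` on `c * g = g * (g⁻¹ * c * g)` in two ways. -/
theorem cocycle_conj (b : Z1 π) (g c : G) :
    π g ((b : G → H) (g⁻¹ * c * g)) =
      (b : G → H) c + (π c ((b : G → H) g) - (b : G → H) g) := by
  have h₁ := cocycle_mul b g (g⁻¹ * c * g)
  have h₂ := cocycle_mul b c g
  rw [show g * (g⁻¹ * c * g) = c * g by group, h₂] at h₁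
  rw [← add_sub_assoc, h₁, add_sub_cancel_left]

/-- On a finite conjugation-invariant set, the values of `π` fix the values of a harmonic cocycle
on the support of the measure. -/
theorem IsHarmonic.apply_eq_of_mem_support {S : Finset G} {μ : G → ℝ}
    (hpos : ∀ s ∈ S, 0 < μ s) {b : Z1 π} (hb : IsHarmonic S μ b) {C : Finset G}
    (hC : ∀ c ∈ C, ∀ g : G, g⁻¹ * c * g ∈ C) {c s : G} (hc : c ∈ C) (hs : s ∈ S) :
    π c ((b : G → H) s) = (b : G → H) s := by
  set d : G → G → H := fun c s => π c ((b : G → H) s) - (b : G → H) s with hd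
  have hexp (c s : G) : ‖d c s‖ ^ 2 = ‖(b : G → H) (s⁻¹ * c * s)‖ ^ 2 - ‖(b : G → H) c‖ ^ 2
      - 2 * RCLike.re (inner 𝕜 ((b : G → H) c) (d c s)) := by
    have h := norm_add_sq (𝕜 := 𝕜) ((b : G → H) c) (d c s)
    rw [← cocycle_conj b s c, LinearIsometryEquiv.norm_map] at h
    linarith
  have hconj (s : G) :
      ∑ c ∈ C, ‖(b : G → H) (s⁻¹ * c * s)‖ ^ 2 = ∑ c ∈ C, ‖(b : G → H) c‖ ^ 2 := by
    refine Finset.sum_nbij' (fun c => s⁻¹ * c * s) (fun c => s * c * s⁻¹) (fun c hc => hC c hc s)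
      (fun c hc => by simpa using hC c hc s⁻¹) ?_ ?_ (fun _ _ => rfl) <;>
    · intro c _
      group
  -- `d c s` is linear in `b s`, so harmonicity passes to it.
  have hcross (c : G) :
      ∑ s ∈ S, μ s * RCLike.re (inner 𝕜 ((b : G → H) c) (d c s)) = 0 := by
    have hz : ∑ s ∈ S, (μ s : 𝕜) • d c s = 0 := by
      have hb' : ∑ s ∈ S, (μ s : 𝕜) • (b : G → H) s = 0 := hb
      simp only [hd, smul_sub, Finset.sum_sub_distrib, hb', ← map_smul, ← map_sum, map_zero,
        sub_zero]
    have h := congrArg (fun v => RCLike.re (inner 𝕜 ((b : G → H) c) v)) hz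
    simpa [inner_sum, inner_smul_right] using h
  have hsum : ∑ s ∈ S, ∑ c ∈ C, μ s * ‖d c s‖ ^ 2 = 0 := by
    have hcross' : ∑ s ∈ S, ∑ c ∈ C, μ s * RCLike.re (inner 𝕜 ((b : G → H) c) (d c s)) = 0 := by
      rw [Finset.sum_comm]
      exact Finset.sum_eq_zero fun c _ => hcross c
    calc ∑ s ∈ S, ∑ c ∈ C, μ s * ‖d c s‖ ^ 2
        = ∑ s ∈ S, (μ s * (∑ c ∈ C, ‖(b : G → H) (s⁻¹ * c * s)‖ ^ 2
              - ∑ c ∈ C, ‖(b : G → H) c‖ ^ 2)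
            - 2 * ∑ c ∈ C, μ s * RCLike.re (inner 𝕜 ((b : G → H) c) (d c s))) := by
          refine Finset.sum_congr rfl fun s _ => ?_
          rw [← Finset.sum_sub_distrib, Finset.mul_sum, Finset.mul_sum, ← Finset.sum_sub_distrib]
          refine Finset.sum_congr rfl fun c _ => ?_
          rw [hexp]
          ring
      _ = 0 := by
          simp only [hconj, sub_self, mul_zero, zero_sub, Finset.sum_neg_distrib,
            ← Finset.mul_sum] at hcross' ⊢
          rw [hcross', mul_zero, neg_zero]
  have hnn (s : G) (hs : s ∈ S) (c : G) : 0 ≤ μ s * ‖d c s‖ ^ 2 :=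
    mul_nonneg (hpos s hs).le (sq_nonneg _)
  have h₁ := (Finset.sum_eq_zero_iff_of_nonneg
    fun s hs => Finset.sum_nonneg fun c _ => hnn s hs c).1 hsum s hs
  have h₂ := (Finset.sum_eq_zero_iff_of_nonneg fun c _ => hnn s hs c).1 h₁ c hc
  have h₃ : ‖d c s‖ ^ 2 = 0 := (mul_eq_zero.1 h₂).resolve_left (hpos s hs).ne'
  exact sub_eq_zero.1 (norm_eq_zero.1 (pow_eq_zero_iff two_ne_zero |>.1 h₃))

/-- Moving `π c` past `π g` conjugates `c` by `g`, so the induction over generators must carry all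
of `C` at once. -/
theorem IsHarmonic.apply_eq {S : Finset G} {μ : G → ℝ}
    (hpos : ∀ s ∈ S, 0 < μ s) (hgen : Subgroup.closure (S : Set G) = ⊤)
    {b : Z1 π} (hb : IsHarmonic S μ b) {C : Finset G}
    (hC : ∀ c ∈ C, ∀ g : G, g⁻¹ * c * g ∈ C) (g : G) :
    ∀ c ∈ C, π c ((b : G → H) g) = (b : G → H) g := by
  have hcomm (c g : G) (v : H) : π c (π g v) = π g (π (g⁻¹ * c * g) v) := by
    change (π c * π g) v = (π g * π (g⁻¹ * c * g)) v
    rw [← map_mul, ← map_mul, mul_assoc, mul_inv_cancel_left]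
  have hg : g ∈ Subgroup.closure (S : Set G) := hgen ▸ Subgroup.mem_top g
  induction hg using Subgroup.closure_induction with
  | mem s hs => exact fun c hc => hb.apply_eq_of_mem_support hpos hC hc hs
  | one => simp [cocycle_one b]
  | mul g h _ _ ihg ihh =>
    intro c hc
    rw [cocycle_mul b, map_add, ihg c hc, hcomm, ihh _ (hC c hc g)]
  | inv g _ ih =>
    intro c hc
    rw [cocycle_inv b, map_neg, hcomm, ih _ (hC c hc g⁻¹)]

/-- A weakly mixing representation has no nonzero vector fixed by the centralizer of an element
of the FC-centre. -/
theorem IsWeaklyMixing.eq_zero_of_centralizer_fixed (hπ : IsWeaklyMixing π) {z : G}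
    (hz : z ∈ fcCenter G) {ξ : H} (hξ : ∀ g : G, Commute g z → π g ξ = ξ) : ξ = 0 := by
  -- `F` represents the right cosets of the centralizer of `z`.
  obtain ⟨F, -, hFbij⟩ := Set.exists_subset_bijOn Set.univ fun h : G => h⁻¹ * z * h
  have hF := hFbij.image_eq
  have hFfin : F.Finite := .of_finite_image (hF ▸ hz) hFbij.injOn
  by_contra hne
  have hpos : 0 < ‖ξ‖ ^ 2 := by positivity
  -- Only nonemptiness of the intersection is needed: some `x` has a small coefficient at every `f *
  -- x`, `f ∈ F`. One of these `f * x` centralizes `z`, where the coefficient is `‖ξ‖ ^ 2`.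
  obtain ⟨T, -, hT⟩ := hπ ξ ξ (‖ξ‖ ^ 2 / 2) (by positivity) (Inv.inv '' F) (hFfin.image _)
  obtain ⟨t, -, x, hx, -⟩ := Set.mem_mul.1 (hT.symm ▸ Set.mem_univ (1 : G))
  obtain ⟨f, hf, hfx⟩ : x⁻¹⁻¹ * z * x⁻¹ ∈ (fun h : G => h⁻¹ * z * h) '' F :=
    hF ▸ Set.mem_image_of_mem (fun h : G => h⁻¹ * z * h) (Set.mem_univ x⁻¹)
  have hmem := Set.mem_iInter₂.1 hx f⁻¹ (Set.mem_image_of_mem _ hf)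
  rw [Set.mem_smul_set_iff_inv_smul_mem, inv_inv, smul_eq_mul] at hmem
  have hcomm : Commute (f * x) z := by
    have h : f⁻¹ * z * f = x * z * x⁻¹ := by simpa using hfx
    calc f * x * z = f * (x * z * x⁻¹) * x := by group
      _ = z * (f * x) := by rw [← h]; group
  have hle : ‖inner 𝕜 ξ (π (f * x) ξ)‖ ≤ ‖ξ‖ ^ 2 / 2 := hmem
  rw [hξ _ hcomm, inner_self_eq_norm_sq_to_K] at hle
  simp at hle
  linarith

end

end FCCocycle

theorem mainTheorem2 {𝕜 : Type*} [RCLike 𝕜] {G : Type*} [Group G] [Group.FG G]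
    {H : Type*} [NormedAddCommGroup H] [InnerProductSpace 𝕜 H] [CompleteSpace H]
    (π : G →* (H ≃ₗᵢ[𝕜] H))
    (hπ : FCCocycle.IsWeaklyMixing π)
    (hH1 : Nontrivial (FCCocycle.ReducedH1 π))
    (S : Finset G) (μ : G → ℝ) (hμ : FCCocycle.IsSymmGenMeasure S μ)
    (b : FCCocycle.Z1 π) (hb : FCCocycle.IsHarmonic S μ b) (hb0 : b ≠ 0) :
    FCCocycle.fcCenter G ⊆
      FCCocycle.cocycleKer b ∩ FCCocycle.kerOn π (FCCocycle.cocycleIm b) := by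
  intro z hz
  have hfin : ((fun h : G => h⁻¹ * z * h) '' Set.univ).Finite := hz
  have hfix (g : G) : π z ((b : G → H) g) = (b : G → H) g := by
    refine hb.apply_eq hμ.pos hμ.generates (C := hfin.toFinset) ?_ g z ?_
    · intro c hc g
      obtain ⟨h, -, rfl⟩ := hfin.mem_toFinset.1 hc
      exact hfin.mem_toFinset.2 ⟨h * g, Set.mem_univ _, by group⟩
    · exact hfin.mem_toFinset.2 ⟨1, Set.mem_univ _, by simp⟩
  refine ⟨hπ.eq_zero_of_centralizer_fixed hz fun g hg => ?_, fun ξ hξ => ?_⟩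
  -- As `g⁻¹ * z * g = z`, the conjugation identity collapses to invariance of `b z`.
  · have h := FCCocycle.cocycle_conj b g z
    rwa [hfix, sub_self, add_zero, mul_assoc, ← hg.eq, inv_mul_cancel_left] at h
  · have hsub : FCCocycle.cocycleIm b ≤
        LinearMap.eqLocus (π z).toLinearIsometry.toLinearMap LinearMap.id := by
      refine Submodule.topologicalClosure_minimal _ (Submodule.span_le.2 ?_) ?_
      · rintro _ ⟨g, rfl⟩
        exact hfix g
      · exact isClosed_eq (π z).continuous continuous_id
    exact hsub hξ
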